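/- A real flow is a triple $(Y,\mathbb{R},S)$ where $Y$ is a compact metric space and $S:\mathbb{R}\times Y\to Y$, $(t,y)\mapsto S_ty$, is a continuous map with $S_0y=y$ and $S_{r+s}y=S_rS_sy$ for all $y\in Y$, $r,s\in\mathbb{R}$. Let $M$ be the set of all infinitely differentiable functions $f:\mathbb{R}\to[-1,1]$ with $|f(s)-f(t)|\le|s-t|$ for all $s,t\in\mathbb{R}$, with the topology of uniform convergence on compact subsets of $\mathbb{R}$, and let $M^{\mathbb{N}}$ carry the product topology. Let $\mathbb{R}$ act continuously on $M^{\mathbb{N}}$ by the translation $\sigma_t\big((f_n)_{n\in\mathbb{N}}\big)=\big(f_n(\cdot+t)\big)_{n\in\mathbb{N}}$. Then the translation on $M^{\mathbb{N}}$ is universal: for every real flow $(Y,\mathbb{R},S)$ there is a map $\phi:Y\to M^{\mathbb{N}}$ which is a homeomorphism onto its image and satisfies $\phi(S_ty)=\sigma_t(\phi(y))$ for all $t\in\mathbb{R}$, $y\in Y$. (The space $M^{\mathbb{N}}$ itself is not compact.) Moreover, $M^{\mathbb{N}}$ contains a compact metrizable $\sigma$-invariant subset $K$ such that $(K,\mathbb{R},\sigma)$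 is a universal real flow, i.e. $(K,\mathbb{R},\sigma)$ is a real flow and every real flow embeds in it by an equivariant topological embedding. -/

import Mathlib

open scoped ContDiff

universe u v

namespace UniversalFlow

/-- The translation `(t, f) ↦ f (· + t)` on continuous functions, where `C(ℝ, ℝ)` carries the
topology of uniform convergence on compact subsets of `ℝ`. -/
def translation : Flow ℝ C(ℝ, ℝ) where
  toFun t f := f.comp ⟨fun s => s + t, by fun_prop⟩
  cont' := by
    apply ContinuousMap.continuous_of_continuous_uncurry
    have h : Continuous fun p : (ℝ × C(ℝ, ℝ)) × ℝ => p.1.2 (p.2 + p.1.1) := by fun_prop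
    exact h
  map_add' t₁ t₂ f := by
    ext s
    change f (s + (t₁ + t₂)) = f (s + t₁ + t₂)
    rw [add_assoc]
  map_zero' f := by
    ext s
    change f (s + 0) = f s
    rw [add_zero]

/-- The set of smooth functions `ℝ → [-1, 1]`. -/
def smoothFunctions : Set C(ℝ, ℝ) :=
  {f | (∀ t, f t ∈ Set.Icc (-1 : ℝ) 1) ∧ ContDiff ℝ ∞ (f : ℝ → ℝ)}

/-- The set of functions `f : ℝ → [-1, 1]` with `|f s - f t| ≤ |s - t|`. -/
def lipschitzFunctions : Set C(ℝ, ℝ) :=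
  {f | (∀ t, f t ∈ Set.Icc (-1 : ℝ) 1) ∧ ∀ s t, |f s - f t| ≤ |s - t|}

theorem isInvariant_smooth_inter_lipschitz :
    IsInvariant translation (smoothFunctions ∩ lipschitzFunctions) := by
  rintro t f ⟨⟨h1, h2⟩, -, h3⟩
  refine ⟨⟨fun s => h1 (s + t), ?_⟩, fun s => h1 (s + t), fun s r => ?_⟩
  · exact h2.comp (contDiff_id.add contDiff_const)
  · have h := h3 (s + t) (r + t)
    rw [add_sub_add_right_eq_sub] at h
    exact h

/-- The coordinatewise flow on the countable self-product `Xᴺ`, with the product topology. -/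
def selfProduct {X : Type*} [TopologicalSpace X] (φ : Flow ℝ X) : Flow ℝ (ℕ → X) where
  toFun t x n := φ t (x n)
  cont' := by
    have h : Continuous fun p : ℝ × (ℕ → X) => fun n => φ p.1 (p.2 n) := by fun_prop
    exact h
  map_add' t₁ t₂ x := funext fun n => φ.map_add t₁ t₂ (x n)
  map_zero' x := funext fun n => φ.map_zero_apply (x n)

/-- The translation on the countable self-product of the space of smooth `1`-Lipschitz functions
`ℝ → [-1, 1]`. -/
def smoothLipschitzFlow :
    Flow ℝ (ℕ → (smoothFunctions ∩ lipschitzFunctions : Set C(ℝ, ℝ))) :=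
  selfProduct (translation.restrict isInvariant_smooth_inter_lipschitz)

/-- There is an equivariant topological embedding of `(Y, ℝ, ψ)` into `(X, ℝ, φ)`. -/
def CanBeEmbedded {Y X : Type*} [TopologicalSpace Y] [TopologicalSpace X]
    (ψ : Flow ℝ Y) (φ : Flow ℝ X) : Prop :=
  ∃ e : Y → X, Topology.IsEmbedding e ∧ ∀ (t : ℝ) (y : Y), e (ψ t y) = φ t (e y)

/-- Every real flow, i.e. every continuous action of `ℝ` on a compact metric space, can be embedded
in `(X, ℝ, φ)`. -/
def EmbedsAllRealFlows {X : Type v} [TopologicalSpace X] (φ : Flow ℝ X) : Prop :=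
  ∀ (Y : Type u) [MetricSpace Y] [CompactSpace Y] (ψ : Flow ℝ Y), CanBeEmbedded ψ φ

/-- `(X, ℝ, φ)` is itself a real flow (on a compact metrizable space) and every real flow can be
embedded in it. -/
structure IsUniversalRealFlow {X : Type v} [TopologicalSpace X] (φ : Flow ℝ X) : Prop where
  compactSpace : CompactSpace X
  metrizableSpace : TopologicalSpace.MetrizableSpace X
  embedsAll : EmbedsAllRealFlows.{u, v} φ

end UniversalFlow

open MeasureTheory ContinuousLinearMap Filter
open scoped Convolution Topology

namespace UniversalFlow

/-! A separating sequence `F n : Y → [-1, 1]` sends `y` to its orbit functions `t ↦ F n (ψ t y)`: a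
continuous, injective, equivariant map into sequences of continuous functions. Convolution with a
bump commutes with translation and, suitably scaled, yields smooth `1`-Lipschitz functions; using
bumps that shrink to `0` loses no information (`eq_of_mollify_eq`). As `Y` is compact, the composite
is an embedding.

Smoothness is not preserved by locally uniform limits, so Arzelà–Ascoli gives compactness only for
`lipschitzFunctions`. The compact set K is therefore the mollified image of all sequences of such
functions. Mollifying twice lands in K: the first pass makes the functions Lipschitz, the second
maps them into K. -/

/-- The space of `1`-Lipschitz functions `ℝ → [-1, 1]` is compact, by Arzelà–Ascoli. -/
theorem isCompact_lipschitzFunctions : IsCompact lipschitzFunctions := by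
  apply ArzelaAscoli.isCompact_of_equicontinuous
  -- The Lipschitz bound survives pointwise limits, so the image is closed in a product of compact
  -- intervals.
  · have h : ContinuousMap.toFun '' lipschitzFunctions =
        Set.univ.pi (fun _ : ℝ => Set.Icc (-1 : ℝ) 1) ∩
          {g | ∀ s t, |g s - g t| ≤ |s - t|} := by
      ext g
      constructor
      · rintro ⟨f, ⟨h1, h2⟩, rfl⟩
        exact ⟨fun t _ => h1 t, h2⟩
      · rintro ⟨h1, h2⟩
        have hg : LipschitzWith 1 g :=
          LipschitzWith.of_dist_le_mul fun s t => by simpa [Real.dist_eq] using h2 s t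
        exact ⟨⟨g, hg.continuous⟩, ⟨fun t => h1 t trivial, h2⟩, rfl⟩
    rw [h]
    refine (isCompact_univ_pi fun _ => isCompact_Icc).inter_right ?_
    simp only [Set.ofPred_forall]
    refine isClosed_iInter fun s => isClosed_iInter fun t => isClosed_le ?_ continuous_const
    fun_prop
  · refine (LipschitzWith.uniformEquicontinuous _ 1 fun f => ?_).equicontinuous
    exact LipschitzWith.of_dist_le_mul fun s t => by simpa [Real.dist_eq] using f.2.2 s t

/-- The continuous functions `ℝ → [-1, 1]`. -/
def unitFunctions : Set C(ℝ, ℝ) := {f | ∀ t, f t ∈ Set.Icc (-1 : ℝ) 1}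

/-! ### Smoothing by convolution -/

section Mollify

variable (φ : ContDiffBump (0 : ℝ))

/-- A fixed bounded interval of integration makes continuity in `(f, x)` jointly a matter of
parametric integrals. -/
theorem convolution_eq_intervalIntegral (f : C(ℝ, ℝ)) (x : ℝ) :
    (φ.normed volume ⋆[lsmul ℝ ℝ, volume] f) x =
      ∫ t in (-φ.rOut)..φ.rOut, φ.normed volume t * f (x - t) := by
  rw [intervalIntegral.integral_eq_integral_of_support_subset]
  · rfl
  · intro t ht
    have h : t ∈ Function.support (φ.normed volume) := left_ne_zero_of_mul ht
    rw [φ.support_normed_eq, Real.ball_eq_Ioo, zero_sub, zero_add] at h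
    exact Set.Ioo_subset_Ioc_self h

theorem continuous_uncurry_convolution :
    Continuous fun p : C(ℝ, ℝ) × ℝ => (φ.normed volume ⋆[lsmul ℝ ℝ, volume] p.1) p.2 := by
  simp only [convolution_eq_intervalIntegral]
  apply intervalIntegral.continuous_parametric_intervalIntegral_of_continuous'
  have := φ.continuous_normed (μ := volume)
  have h : Continuous fun q : (C(ℝ, ℝ) × ℝ) × ℝ =>
      φ.normed volume q.2 * q.1.1 (q.1.2 - q.2) := by fun_prop
  exact h

/-- The scaling factor that makes mollified functions `1`-Lipschitz. -/
noncomputable def mollifyScale : ℝ := (1 + ∫ t, |deriv (φ.normed volume) t|)⁻¹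

theorem one_le_mollifyScale_inv : 1 ≤ 1 + ∫ t, |deriv (φ.normed volume) t| :=
  le_add_of_nonneg_right (integral_nonneg fun _ => abs_nonneg _)

theorem mollifyScale_pos : 0 < mollifyScale φ :=
  inv_pos.2 (zero_lt_one.trans_le (one_le_mollifyScale_inv φ))

theorem mollifyScale_le_one : mollifyScale φ ≤ 1 :=
  inv_le_one_of_one_le₀ (one_le_mollifyScale_inv φ)

theorem mollifyScale_mul_le_one :
    mollifyScale φ * ∫ t, |deriv (φ.normed volume) t| ≤ 1 := by
  rw [mollifyScale, inv_mul_le_one₀ (zero_lt_one.trans_le (one_le_mollifyScale_inv φ))]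
  exact le_add_of_nonneg_left zero_le_one

/-- The convolution of a continuous function with a normed bump function, scaled so that functions
with values in `[-1, 1]` become `1`-Lipschitz. -/
noncomputable def mollify (f : C(ℝ, ℝ)) : C(ℝ, ℝ) where
  toFun x := mollifyScale φ * (φ.normed volume ⋆[lsmul ℝ ℝ, volume] f) x
  continuous_toFun := continuous_const.mul <|
    (continuous_uncurry_convolution φ).comp (by fun_prop : Continuous fun x : ℝ => (f, x))

theorem mollify_apply (f : C(ℝ, ℝ)) (x : ℝ) :
    mollify φ f x = mollifyScale φ * (φ.normed volume ⋆[lsmul ℝ ℝ, volume] f) x := rfl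

theorem continuous_mollify : Continuous (mollify φ) :=
  ContinuousMap.continuous_of_continuous_uncurry _
    (continuous_const.mul (continuous_uncurry_convolution φ))

theorem mollify_translation (t : ℝ) (f : C(ℝ, ℝ)) :
    mollify φ (translation t f) = translation t (mollify φ f) := by
  ext x
  change mollifyScale φ * _ = mollifyScale φ * _
  congr 1
  change ∫ s, φ.normed volume s * f (x - s + t) = ∫ s, φ.normed volume s * f (x + t - s)
  simp only [sub_add_eq_add_sub]

/-- Convolving an integrable function with one bounded by `1` gives at most its `L¹` norm. -/
theorem abs_convolution_le {g : ℝ → ℝ} (hg : Integrable g) {f : C(ℝ, ℝ)}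
    (hf : f ∈ unitFunctions) (x : ℝ) :
    |(g ⋆[lsmul ℝ ℝ, volume] f) x| ≤ ∫ t, |g t| := by
  change ‖∫ t, g t * f (x - t)‖ ≤ _
  refine norm_integral_le_of_norm_le hg.abs (Eventually.of_forall fun t => ?_)
  rw [norm_mul]
  exact mul_le_of_le_one_right (norm_nonneg _) (abs_le.2 (hf _))

theorem contDiff_convolution (f : C(ℝ, ℝ)) :
    ContDiff ℝ ∞ (φ.normed volume ⋆[lsmul ℝ ℝ, volume] f) :=
  φ.hasCompactSupport_normed.contDiff_convolution_left _ φ.contDiff_normed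
    f.continuous.locallyIntegrable

/-- The bump has integral `1`, so values stay in `[-1, 1]`. The derivative falls on the bump, so it
is bounded by the `L¹` norm of the bump's derivative, which the scale absorbs. -/
theorem mollify_mem {f : C(ℝ, ℝ)} (hf : f ∈ unitFunctions) :
    mollify φ f ∈ smoothFunctions ∩ lipschitzFunctions := by
  have hmem : ∀ t, mollify φ f t ∈ Set.Icc (-1 : ℝ) 1 := by
    intro t
    rw [Set.mem_Icc, ← abs_le, mollify_apply, abs_mul, abs_of_pos (mollifyScale_pos φ)]
    refine mul_le_one₀ (mollifyScale_le_one φ) (abs_nonneg _) ?_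
    refine (abs_convolution_le φ.integrable_normed hf t).trans_eq ?_
    simp only [abs_of_nonneg (φ.nonneg_normed _), φ.integral_normed]
  have hdiff : ContDiff ℝ ∞ (mollify φ f) := contDiff_const.mul (contDiff_convolution φ f)
  refine ⟨⟨hmem, hdiff⟩, hmem, fun s t => ?_⟩
  have hφ : ContDiff ℝ 1 (φ.normed volume) := φ.contDiff_normed
  have hderiv (x : ℝ) : HasDerivAt (mollify φ f)
      (mollifyScale φ * (deriv (φ.normed volume) ⋆[lsmul ℝ ℝ, volume] f) x) x :=
    (HasCompactSupport.hasDerivAt_convolution_left _ φ.hasCompactSupport_normed hφ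
      f.continuous.locallyIntegrable x).const_mul _
  have hint : Integrable (deriv (φ.normed volume)) :=
    (hφ.continuous_deriv le_rfl).integrable_of_hasCompactSupport φ.hasCompactSupport_normed.deriv
  have h := Convex.norm_image_sub_le_of_norm_hasDerivWithin_le (C := 1)
    (fun x _ => (hderiv x).hasDerivWithinAt) (fun x _ => ?_) convex_univ
    (Set.mem_univ t) (Set.mem_univ s)
  · simpa using h
  · rw [norm_mul, Real.norm_of_nonneg (mollifyScale_pos φ).le]
    exact (mul_le_mul_of_nonneg_left (abs_convolution_le hint hf x)
      (mollifyScale_pos φ).le).trans (mollifyScale_mul_le_one φ)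

end Mollify

/-- A sequence of bump functions whose supports shrink to `0`. -/
noncomputable def shrinkingBump (k : ℕ) : ContDiffBump (0 : ℝ) where
  rIn := 1 / ((k : ℝ) + 1) / 2
  rOut := 1 / ((k : ℝ) + 1)
  rIn_pos := by positivity
  rIn_lt_rOut := half_lt_self (by positivity)

/-- The unscaled convolutions converge pointwise to the function; the scale depends on `k` but is
nonzero, so it cancels. -/
theorem eq_of_mollify_eq {f g : C(ℝ, ℝ)}
    (h : ∀ k, mollify (shrinkingBump k) f = mollify (shrinkingBump k) g) : f = g := by
  ext x
  have hlim (f : C(ℝ, ℝ)) := ContDiffBump.convolution_tendsto_right_of_continuous (μ := volume)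
    (φ := shrinkingBump) tendsto_one_div_add_atTop_nhds_zero_nat f.continuous x
  refine tendsto_nhds_unique (hlim f) ?_
  convert hlim g using 2 with k
  have := DFunLike.congr_fun (h k) x
  exact mul_left_cancel₀ (mollifyScale_pos _).ne' this

/-- All mollifications of all the members of a sequence of functions. -/
noncomputable def mollifySeq (x : ℕ → unitFunctions) :
    ℕ → (smoothFunctions ∩ lipschitzFunctions : Set C(ℝ, ℝ)) :=
  fun n => ⟨mollify (shrinkingBump n.unpair.2) (x n.unpair.1), mollify_mem _ (x n.unpair.1).2⟩

theorem continuous_mollifySeq : Continuous mollifySeq :=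
  continuous_pi fun _ => Continuous.subtype_mk ((continuous_mollify _).comp (by fun_prop)) _

theorem mollifySeq_injective : Function.Injective mollifySeq := by
  intro x y h
  refine funext fun m => Subtype.ext (eq_of_mollify_eq fun k => ?_)
  simpa [mollifySeq] using congrArg Subtype.val (congrFun h (Nat.pair m k))

/-- Relating `x` and `y` by a hypothesis avoids a flow on sequences in `unitFunctions`. -/
theorem mollifySeq_equivariant {t : ℝ} {x y : ℕ → unitFunctions}
    (h : ∀ n, (y n : C(ℝ, ℝ)) = translation t (x n)) :
    mollifySeq y = smoothLipschitzFlow t (mollifySeq x) :=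
  funext fun n => Subtype.ext <|
    (congrArg _ (h n.unpair.1)).trans (mollify_translation _ t (x n.unpair.1))

/-! ### Coding points by their orbits -/

/-- The functions along the orbits of a flow, for a sequence of functions on the phase space. -/
def orbitFunctions {Y : Type*} [TopologicalSpace Y] (ψ : Flow ℝ Y)
    (F : ℕ → C(Y, ℝ)) (hF : ∀ n y, F n y ∈ Set.Icc (-1 : ℝ) 1) (y : Y) : ℕ → unitFunctions :=
  fun n => ⟨(F n).comp ⟨fun t => ψ t y, by fun_prop⟩, fun t => hF n (ψ t y)⟩

/-- On a compact metric space, countably many functions with values in `[-1, 1]` separate the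
points. -/
theorem exists_separating_sequence (Y : Type*) [MetricSpace Y] [CompactSpace Y] :
    ∃ F : ℕ → C(Y, ℝ), (∀ n y, F n y ∈ Set.Icc (-1 : ℝ) 1) ∧
      ∀ y z, (∀ n, F n y = F n z) → y = z := by
  cases isEmpty_or_nonempty Y
  · exact ⟨fun _ => 0, fun _ y => isEmptyElim y, fun y => isEmptyElim y⟩
  refine ⟨fun n => ⟨fun y => min 1 (dist y (TopologicalSpace.denseSeq Y n)), by fun_prop⟩,
    fun n y => ⟨?_, min_le_left _ _⟩, fun y z h => ?_⟩
  · exact (by norm_num : (-1 : ℝ) ≤ 0).trans (le_min zero_le_one dist_nonneg)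
  -- Agreement on a dense sequence extends to all `q`; then take `q = y`.
  · have heq : (fun q => min 1 (dist y q)) = fun q => min 1 (dist z q) :=
      (TopologicalSpace.denseRange_denseSeq Y).equalizer (by fun_prop) (by fun_prop) (funext h)
    have hy : min 1 (dist z y) = 0 := by simpa using (congrFun heq y).symm
    rcases min_eq_iff.1 hy with h' | h'
    · exact absurd h'.1 one_ne_zero
    · exact (dist_eq_zero.1 h'.1).symm

/-- Every real flow admits a continuous injective equivariant map to the translation on
`C(ℝ, [-1, 1])ᴺ`. -/
theorem exists_orbitFunctions (Y : Type*) [MetricSpace Y] [CompactSpace Y] (ψ : Flow ℝ Y) :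
    ∃ e : Y → ℕ → unitFunctions, Continuous e ∧ Function.Injective e ∧
      ∀ t y n, (e (ψ t y) n : C(ℝ, ℝ)) = translation t (e y n) := by
  obtain ⟨F, hF, hsep⟩ := exists_separating_sequence Y
  refine ⟨orbitFunctions ψ F hF, ?_, fun y z h => hsep y z fun n => ?_, fun t y n => ?_⟩
  · refine continuous_pi fun n => Continuous.subtype_mk ?_ _
    apply ContinuousMap.continuous_of_continuous_uncurry
    have h : Continuous fun p : Y × ℝ => F n (ψ p.2 p.1) := by fun_prop
    exact h
  -- Time `0` recovers the values `F n y`.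
  · have h0 := DFunLike.congr_fun (congrArg Subtype.val (congrFun h n)) 0
    change F n (ψ 0 y) = F n (ψ 0 z) at h0
    simpa using h0
  · ext s
    change F n (ψ s (ψ t y)) = F n (ψ (s + t) y)
    rw [ψ.map_add]

/-! ### The compact invariant set -/

/-- The sequences of `1`-Lipschitz functions `ℝ → [-1, 1]`. -/
def lipschitzSequences : Set (ℕ → unitFunctions) := {x | ∀ n, (x n : C(ℝ, ℝ)) ∈ lipschitzFunctions}

theorem isCompact_lipschitzSequences : IsCompact lipschitzSequences := by
  have h : IsCompact ((↑) ⁻¹' lipschitzFunctions : Set unitFunctions) := by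
    rw [Subtype.isCompact_iff, Subtype.image_preimage_coe,
      Set.inter_eq_right.2 fun f hf => hf.1]
    exact isCompact_lipschitzFunctions
  convert isCompact_univ_pi fun _ : ℕ => h using 1
  ext x
  simp [lipschitzSequences]

/-- The compact set of mollifications of sequences of `1`-Lipschitz functions. -/
noncomputable def mollifiedSequences :
    Set (ℕ → (smoothFunctions ∩ lipschitzFunctions : Set C(ℝ, ℝ))) :=
  mollifySeq '' lipschitzSequences

theorem isCompact_mollifiedSequences : IsCompact mollifiedSequences :=
  isCompact_lipschitzSequences.image continuous_mollifySeq

/-- A sequence of smooth `1`-Lipschitz functions, seen as a sequence of continuous functions. -/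
def toUnit (x : ℕ → (smoothFunctions ∩ lipschitzFunctions : Set C(ℝ, ℝ))) : ℕ → unitFunctions :=
  fun n => ⟨x n, (x n).2.2.1⟩

theorem isInvariant_mollifiedSequences : IsInvariant smoothLipschitzFlow mollifiedSequences := by
  rintro t _ ⟨x, hx, rfl⟩
  refine ⟨fun n => ⟨translation t (x n), fun s => (x n).2 (s + t)⟩, fun n => ?_,
    mollifySeq_equivariant fun n => rfl⟩
  refine ⟨fun s => (x n).2 (s + t), fun s r => ?_⟩
  have h := (hx n).2 (s + t) (r + t)
  rw [add_sub_add_right_eq_sub] at h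
  exact h

theorem continuous_toUnit : Continuous toUnit :=
  continuous_pi fun n => Continuous.subtype_mk (by fun_prop) _

theorem toUnit_injective : Function.Injective toUnit := fun _ _ h =>
  funext fun n => Subtype.ext (congrArg (fun z : ℕ → unitFunctions => (z n : C(ℝ, ℝ))) h)

/-- Every real flow embeds in the translation on `Mᴺ`, with image in `mollifiedSequences`. -/
theorem exists_embedding_mollifiedSequences (Y : Type*) [MetricSpace Y] [CompactSpace Y]
    (ψ : Flow ℝ Y) :
    ∃ e : Y → ℕ → (smoothFunctions ∩ lipschitzFunctions : Set C(ℝ, ℝ)),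
      Topology.IsEmbedding e ∧ (∀ t y, e (ψ t y) = smoothLipschitzFlow t (e y)) ∧
        ∀ y, e y ∈ mollifiedSequences := by
  obtain ⟨e, hc, hi, he⟩ := exists_orbitFunctions Y ψ
  refine ⟨fun y => mollifySeq (toUnit (mollifySeq (e y))), ?_, fun t y => ?_, fun y => ?_⟩
  -- A continuous injection from a compact space to a Hausdorff space is a closed embedding.
  · refine (Continuous.isClosedEmbedding ?_ ?_).isEmbedding
    · exact continuous_mollifySeq.comp (continuous_toUnit.comp (continuous_mollifySeq.comp hc))
    · exact mollifySeq_injective.comp (toUnit_injective.comp (mollifySeq_injective.comp hi))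
  · refine mollifySeq_equivariant fun n => ?_
    exact congrArg (fun x => (x n : C(ℝ, ℝ))) (mollifySeq_equivariant (he t y))
  · exact ⟨_, fun n => (mollifySeq (e y) n).2.2, rfl⟩

end UniversalFlow

theorem mainTheorem4 :
    UniversalFlow.EmbedsAllRealFlows.{u} UniversalFlow.smoothLipschitzFlow ∧
      ∃ (K : Set (ℕ → (UniversalFlow.smoothFunctions ∩ UniversalFlow.lipschitzFunctions :
            Set C(ℝ, ℝ))))
        (hK : IsInvariant UniversalFlow.smoothLipschitzFlow K),
        UniversalFlow.IsUniversalRealFlow.{u} (UniversalFlow.smoothLipschitzFlow.restrict hK) := by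
  refine ⟨fun Y _ _ ψ => ?_, UniversalFlow.mollifiedSequences,
    UniversalFlow.isInvariant_mollifiedSequences,
    isCompact_iff_compactSpace.1 UniversalFlow.isCompact_mollifiedSequences, inferInstance,
    fun Y _ _ ψ => ?_⟩
  · obtain ⟨e, h, he, -⟩ := UniversalFlow.exists_embedding_mollifiedSequences Y ψ
    exact ⟨e, h, he⟩
  · obtain ⟨e, h, he, hK⟩ := UniversalFlow.exists_embedding_mollifiedSequences Y ψ
    exact ⟨fun y => ⟨e y, hK y⟩, h.codRestrict _ hK, fun t y => Subtype.ext (he t y)⟩
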